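/- Let $E$ be a complex Banach space, and let $\mathscr{L}(E)$ be the space of bounded linear operators on $E$. An operator $T\in\mathscr{L}(E)$ is called power-bounded if $\sup_{n\ge 1}\|T^n\|<\infty$, power-bounded below if $\inf_{n\ge 1}\|T^n x\|>0$ for every $x\in E\setminus\{0\}$, and doubly power-bounded if $T$ is invertible and both $T$ and $T^{-1}$ are power-bounded. We say that $T$ has relatively compact orbits on a subset $A\subseteq E$ if $\{T^n y : n\ge 1\}$ is relatively compact in $E$ for every $y\in A$. Write $\operatorname{rg}(S)$ for the range of an operator $S$, and $\mathrm{c}_0$ for the Banach space of complex null sequences with the supremum norm; $E$ contains a copy of $\mathrm{c}_0$ if some linear subspace of $E$ is linearly homeomorphic to $\mathrm{c}_0$. Consider the following assertions. (a) $E$ does not contain a copy of $\mathrm{c}_0$. (b) For every power-bounded operator $T\in\mathscr{L}(E)$ which is power-bounded below, the following two assertions are equivalent: (i) $T$ has relatively compact orbits on $\operatorname{rg}(I-T^m)$ for some integer $m\ge 1$; (ii) $T$ has relatively compact orbits on $\operatorname{rg}(I-T^m)$ for each integer $m\ge 1$. (c) For every doubly power-bounded operator $T\in\mathscr{L}(E)$,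 assertions (i) and (ii) are equivalent. Then (a) $\Rightarrow$ (b) $\Rightarrow$ (c). If $E$ is separable, then (a), (b) and (c) are equivalent. -/

import Mathlib

open scoped ZeroAtInfty

/-- `E` contains a copy of `c₀`: some linear subspace of `E` is linearly homeomorphic to the
complex Banach space `c₀` (such a subspace is automatically closed in `E`). Since `ℕ` is discrete,
`C₀(ℕ, ℂ)` is the space of complex null sequences with the supremum norm. -/
def ContainsCopyOfC0 (E : Type*) [NormedAddCommGroup E] [NormedSpace ℂ E] : Prop :=
  ∃ F : Submodule ℂ E, Nonempty (C₀(ℕ, ℂ) ≃L[ℂ] F)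

/-- `T` is power-bounded: the operator norms of the powers of `T` are uniformly bounded. -/
def IsPowerBounded {E : Type*} [NormedAddCommGroup E] [NormedSpace ℂ E] (T : E →L[ℂ] E) : Prop :=
  ∃ C : ℝ, ∀ n : ℕ, ‖T ^ n‖ ≤ C

/-- `T` is power-bounded below: `inf_n ‖T ^ n x‖ > 0` for every `x ≠ 0`.
(The term `n = 0` is harmless, because `x ≠ 0`.) -/
def IsPowerBoundedBelow {E : Type*} [NormedAddCommGroup E] [NormedSpace ℂ E]
    (T : E →L[ℂ] E) : Prop :=
  ∀ x : E, x ≠ 0 → 0 < ⨅ n : ℕ, ‖(T ^ n) x‖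

/-- `T` is doubly power-bounded: `T` is invertible (with bounded inverse), and both `T` and its
inverse are power-bounded. -/
def IsDoublyPowerBounded {E : Type*} [NormedAddCommGroup E] [NormedSpace ℂ E]
    (T : E →L[ℂ] E) : Prop :=
  ∃ U : (E →L[ℂ] E)ˣ, (U : E →L[ℂ] E) = T ∧ IsPowerBounded (U : E →L[ℂ] E) ∧
    IsPowerBounded ((U⁻¹ : (E →L[ℂ] E)ˣ) : E →L[ℂ] E)

/-- `T` has relatively compact orbits on `A`: for every `y ∈ A` the orbit `{T ^ n y}` has compact
closure in `E`. -/
def HasRelCompactOrbitsOn {E : Type*} [NormedAddCommGroup E] [NormedSpace ℂ E]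
    (T : E →L[ℂ] E) (A : Set E) : Prop :=
  ∀ y ∈ A, IsCompact (closure (Set.range fun n : ℕ => (T ^ n) y))

/-- For `T` the following are equivalent: `T` has relatively compact orbits on `rg (I - T ^ m)` for
some positive integer `m`; the same for each positive integer `m`. -/
def SomeIffEachRelCompactOrbits {E : Type*} [NormedAddCommGroup E] [NormedSpace ℂ E]
    (T : E →L[ℂ] E) : Prop :=
  (∃ m : ℕ, 1 ≤ m ∧ HasRelCompactOrbitsOn T (Set.range (1 - T ^ m : E →L[ℂ] E))) ↔
    (∀ m : ℕ, 1 ≤ m → HasRelCompactOrbitsOn T (Set.range (1 - T ^ m : E →L[ℂ] E)))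

/-!
If `E` contains no copy of `c₀`, relative compactness of the orbit of `(1 - T ^ m) x` passes to the
orbit of `x`, by a discrete form of the Kadets theorem on integrals of almost periodic functions.
Write `T ^ t x - x` as a sum of differences `T ^ τ x - x` over almost periods `τ` of `T x - x`: if
arbitrarily good almost periods left `‖T ^ τ x - x‖` bounded away from `0`, then a sequence of such
differences would have bounded finite sums, and by Bessaga and Pełczyński would span a copy of `c₀`.

Conversely, by Sobczyk's theorem a copy of `c₀` in a separable space is complemented, so an operator
on `c₀`, or on the isomorphic space `c` of convergent sequences, extends to `E` by the identity on a
complement. Let `T` be multiplication on `c` by roots of unity `u n → -1` of order `2 ^ (n + 2)`.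
The range of `1 - T ^ 2` consists of null sequences, whose orbits are uniformly approximated by
periodic ones; but the orbit of `(1 - T) 1`, a sequence with limit `2`, is not relatively compact,
since it is separated along the powers `T ^ 2 ^ (n + 1)`.
-/

open Filter Topology
open scoped OnePoint

theorem exists_injective_sum_le_of_sum_le {ε : ℝ} (hε : 0 ≤ ε) (r : ℕ) (a : ℕ → ℕ → ℝ)
    (h : ∀ i (A : Finset ℕ), ∑ j ∈ A, a i j ≤ r * ε) :
    ∃ σ : ℕ → ℕ, Function.Injective σ ∧
      ∀ i (A : Finset ℕ), i ∉ A → ∑ j ∈ A, a (σ i) (σ j) ≤ ε := by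
  induction r generalizing a with
  | zero =>
    refine ⟨id, Function.injective_id, fun i A _ => ?_⟩
    exact (by simpa using h i A : ∑ j ∈ A, a i j ≤ 0).trans hε
  | succ r ih =>
    -- Partition `ℕ` into the infinite blocks `{pair p i | i}`. If no block works, each contains a
    -- bad row; along these rows the sums within the block exceed `ε`, so that at most `r * ε` is
    -- left for the sums over the representatives of the blocks.
    by_cases hblock : ∃ p, ∀ i (A : Finset ℕ), i ∉ A →
        ∑ j ∈ A, a (Nat.pair p i) (Nat.pair p j) ≤ ε
    · obtain ⟨p, hp⟩ := hblock
      exact ⟨Nat.pair p, fun i j hij => (Nat.pair_eq_pair.1 hij).2, hp⟩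
    · push Not at hblock
      choose q A hqA hA using hblock
      let τ : ℕ ↪ ℕ := ⟨fun p => Nat.pair p (q p), fun i j hij => (Nat.pair_eq_pair.1 hij).1⟩
      let block (p : ℕ) : ℕ ↪ ℕ := ⟨Nat.pair p, fun i j hij => (Nat.pair_eq_pair.1 hij).2⟩
      have hdisj (i : ℕ) (B : Finset ℕ) : Disjoint (B.map τ) ((A i).map (block i)) := by
        simp only [Finset.disjoint_left, Finset.mem_map, not_exists, not_and]
        rintro _ ⟨j, -, rfl⟩ k hk hjk
        obtain ⟨rfl, rfl⟩ := Nat.pair_eq_pair.1 hjk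
        exact hqA _ hk
      have hsum (i : ℕ) (B : Finset ℕ) : ∑ j ∈ B, a (τ i) (τ j) ≤ r * ε := by
        have htotal := h (τ i) (B.map τ ∪ (A i).map (block i))
        rw [Finset.sum_union (hdisj i B), Finset.sum_map, Finset.sum_map] at htotal
        have hbad : ε < ∑ j ∈ A i, a (τ i) (block i j) := hA i
        push_cast at htotal
        linarith
      obtain ⟨σ, hσ, hσε⟩ := ih (fun i j => a (τ i) (τ j)) hsum
      exact ⟨τ ∘ σ, τ.injective.comp hσ, hσε⟩

theorem sum_abs_le_two_mul_of_abs_sum_le {ι : Type*} {u : ι → ℝ} {M : ℝ}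
    (h : ∀ A : Finset ι, |∑ i ∈ A, u i| ≤ M) (A : Finset ι) : ∑ i ∈ A, |u i| ≤ 2 * M :=
  calc ∑ i ∈ A, |u i|
      = ∑ i ∈ A with 0 ≤ u i, |u i| + ∑ i ∈ A with ¬ 0 ≤ u i, |u i| :=
        (Finset.sum_filter_add_sum_filter_not A _ _).symm
    _ = ∑ i ∈ A with 0 ≤ u i, u i + -∑ i ∈ A with ¬ 0 ≤ u i, u i := by
        rw [← Finset.sum_neg_distrib]
        congr 1 <;> refine Finset.sum_congr rfl fun i hi => ?_
        · exact abs_of_nonneg (Finset.mem_filter.1 hi).2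
        · exact abs_of_neg (not_le.1 (Finset.mem_filter.1 hi).2)
    _ ≤ M + M := add_le_add (le_of_abs_le (h _)) ((neg_le_abs _).trans (h _))
    _ = 2 * M := (two_mul M).symm

theorem norm_le_norm_add_of_hasSum {ι E : Type*} [SeminormedAddCommGroup E] {y : ι → E} {s : E}
    (hs : HasSum y s) {i : ι} {B : ℝ} (hB : ∀ A : Finset ι, i ∉ A → ∑ j ∈ A, ‖y j‖ ≤ B) :
    ‖y i‖ ≤ ‖s‖ + B := by
  classical
  refine ge_of_tendsto (hs.norm.add_const B) ?_
  filter_upwards [eventually_ge_atTop {i}] with A hA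
  rw [← Finset.add_sum_erase A y (Finset.singleton_subset_iff.1 hA)]
  linarith [norm_sub_le_norm_add (y i) (∑ j ∈ A.erase i, y j),
    norm_sum_le_of_le _ fun j (_ : j ∈ A.erase i) => le_refl ‖y j‖,
    hB _ (Finset.notMem_erase i A)]

section ZeroAtInfty

theorem norm_zeroAtInfty_apply_le {X F : Type*} [TopologicalSpace X] [SeminormedAddCommGroup F]
    (c : C₀(X, F)) (i : X) : ‖c i‖ ≤ ‖c‖ :=
  c.toBCF.norm_coe_le_norm i

theorem norm_zeroAtInfty_le {X F : Type*} [TopologicalSpace X] [SeminormedAddCommGroup F]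
    {c : C₀(X, F)} {b : ℝ} (hb : 0 ≤ b) (h : ∀ i, ‖c i‖ ≤ b) : ‖c‖ ≤ b :=
  (BoundedContinuousFunction.norm_le (f := c.toBCF) hb).2 h

theorem tendsto_zeroAtInfty_cofinite {X F : Type*} [TopologicalSpace X] [DiscreteTopology X]
    [TopologicalSpace F] [Zero F] (c : C₀(X, F)) : Tendsto c cofinite (𝓝 0) := by
  rw [← cocompact_eq_cofinite]
  exact zero_at_infty c

variable {X 𝕜 E : Type*} [TopologicalSpace X] [NontriviallyNormedField 𝕜]
  [NormedAddCommGroup E] [NormedSpace 𝕜 E]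

variable (𝕜) in
/-- Evaluation at a point, as a bounded functional on `C₀(X, 𝕜)`; for discrete `X` these are the
coordinate functionals of `c₀(X)`. -/
noncomputable def zeroAtInftyEvalCLM (i : X) : C₀(X, 𝕜) →L[𝕜] 𝕜 :=
  LinearMap.mkContinuous
    { toFun := fun c => c i, map_add' := fun _ _ => rfl, map_smul' := fun _ _ => rfl } 1
    fun c => (norm_zeroAtInfty_apply_le c i).trans_eq (one_mul _).symm

theorem zeroAtInftyEvalCLM_apply (i : X) (c : C₀(X, 𝕜)) : zeroAtInftyEvalCLM 𝕜 i c = c i := rfl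

theorem norm_zeroAtInftyEvalCLM_le (i : X) : ‖zeroAtInftyEvalCLM 𝕜 i‖ ≤ 1 :=
  LinearMap.mkContinuous_norm_le _ zero_le_one _

/-- The operator `x ↦ (f i x)ᵢ` into `c₀(X)` given by a bounded family of functionals which is
weak-* null along the cofinite filter. -/
noncomputable def toZeroAtInftyCLM [DiscreteTopology X] (f : X → E →L[𝕜] 𝕜) (M : NNReal)
    (hM : ∀ i, ‖f i‖ ≤ M) (hf : ∀ x, Tendsto (fun i => f i x) cofinite (𝓝 0)) :
    E →L[𝕜] C₀(X, 𝕜) :=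
  LinearMap.mkContinuous
    { toFun := fun x =>
        { toFun := fun i => f i x
          continuous_toFun := continuous_of_discreteTopology
          zero_at_infty' := by simpa only [cocompact_eq_cofinite] using hf x }
      map_add' := fun x y => by ext i; exact map_add (f i) x y
      map_smul' := fun a x => by ext i; exact map_smul (f i) a x }
    M fun x => norm_zeroAtInfty_le (by positivity) fun i => (f i).le_of_opNorm_le (hM i) x

theorem toZeroAtInftyCLM_apply [DiscreteTopology X] (f : X → E →L[𝕜] 𝕜) (M : NNReal)
    (hM : ∀ i, ‖f i‖ ≤ M) (hf : ∀ x, Tendsto (fun i => f i x) cofinite (𝓝 0)) (x : E) (i : X) :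
    toZeroAtInftyCLM f M hM hf x i = f i x := rfl

end ZeroAtInfty

section BessagaPelczynski

variable {ι 𝕜 E : Type*} [RCLike 𝕜] [NormedAddCommGroup E] [NormedSpace 𝕜 E]

theorem norm_le_abs_re_add_abs_im (z : 𝕜) : ‖z‖ ≤ |RCLike.re z| + |RCLike.im z| := by
  refine abs_le_of_sq_le_sq' ?_ (by positivity) |>.2
  rw [RCLike.norm_sq_eq_def, add_sq, sq_abs, sq_abs]
  nlinarith [mul_nonneg (abs_nonneg (RCLike.re z)) (abs_nonneg (RCLike.im z))]

theorem sum_norm_le_four_mul_of_norm_sum_le {z : ι → 𝕜} {M : ℝ}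
    (h : ∀ A : Finset ι, ‖∑ i ∈ A, z i‖ ≤ M) (A : Finset ι) : ∑ i ∈ A, ‖z i‖ ≤ 4 * M := by
  have hre : ∑ i ∈ A, |RCLike.re (z i)| ≤ 2 * M := sum_abs_le_two_mul_of_abs_sum_le (fun B => by
    rw [← map_sum]
    exact (RCLike.abs_re_le_norm _).trans (h B)) A
  have him : ∑ i ∈ A, |RCLike.im (z i)| ≤ 2 * M := sum_abs_le_two_mul_of_abs_sum_le (fun B => by
    rw [← map_sum]
    exact (RCLike.abs_im_le_norm _).trans (h B)) A
  calc ∑ i ∈ A, ‖z i‖ ≤ ∑ i ∈ A, (|RCLike.re (z i)| + |RCLike.im (z i)|) :=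
        Finset.sum_le_sum fun i _ => norm_le_abs_re_add_abs_im (z i)
    _ ≤ 4 * M := by rw [Finset.sum_add_distrib]; linarith

theorem sum_norm_apply_le_of_norm_sum_le {x : ι → E} {M : ℝ}
    (h : ∀ A : Finset ι, ‖∑ i ∈ A, x i‖ ≤ M) {f : E →L[𝕜] 𝕜} (hf : ‖f‖ ≤ 1) (A : Finset ι) :
    ∑ i ∈ A, ‖f (x i)‖ ≤ 4 * M :=
  sum_norm_le_four_mul_of_norm_sum_le (fun B => by
    rw [← map_sum]
    exact (f.le_of_opNorm_le hf _).trans ((one_mul _).trans_le (h B))) A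

theorem norm_sum_smul_le_of_norm_sum_le {x : ι → E} {M : ℝ}
    (h : ∀ A : Finset ι, ‖∑ i ∈ A, x i‖ ≤ M) {c : ι → 𝕜} {b : ℝ} (hb : 0 ≤ b) {A : Finset ι}
    (hc : ∀ i ∈ A, ‖c i‖ ≤ b) : ‖∑ i ∈ A, c i • x i‖ ≤ 4 * M * b := by
  obtain ⟨f, hf, hfx⟩ := exists_dual_vector'' 𝕜 (∑ i ∈ A, c i • x i)
  calc ‖∑ i ∈ A, c i • x i‖ = ‖f (∑ i ∈ A, c i • x i)‖ := by rw [hfx]; simp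
    _ = ‖∑ i ∈ A, c i * f (x i)‖ := by simp only [map_sum, map_smul, smul_eq_mul]
    _ ≤ ∑ i ∈ A, b * ‖f (x i)‖ := norm_sum_le_of_le _ fun i hi => by
        rw [norm_mul]
        exact mul_le_mul_of_nonneg_right (hc i hi) (norm_nonneg _)
    _ = (∑ i ∈ A, ‖f (x i)‖) * b := by rw [← Finset.mul_sum, mul_comm]
    _ ≤ 4 * M * b := mul_le_mul_of_nonneg_right (sum_norm_apply_le_of_norm_sum_le h hf A) hb

variable [CompleteSpace E]

theorem summable_smul_of_norm_sum_le {x : ι → E} {M : ℝ}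
    (h : ∀ A : Finset ι, ‖∑ i ∈ A, x i‖ ≤ M) {c : ι → 𝕜} (hc : Tendsto c cofinite (𝓝 0)) :
    Summable fun i => c i • x i := by
  have hM : 0 ≤ M := (norm_nonneg _).trans (h ∅)
  rw [summable_iff_vanishing_norm]
  intro ε hε
  have hb : 0 < ε / (4 * M + 1) := by positivity
  have hfin : {i | ¬ ‖c i‖ < ε / (4 * M + 1)}.Finite :=
    (tendsto_zero_iff_norm_tendsto_zero.1 hc).eventually_lt_const hb
  refine ⟨hfin.toFinset, fun A hA => ?_⟩
  have hcA : ∀ i ∈ A, ‖c i‖ ≤ ε / (4 * M + 1) := fun i hi =>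
    not_lt.1 fun hlt => Finset.disjoint_left.1 hA hi (hfin.mem_toFinset.2 (not_lt.2 hlt.le))
  refine (norm_sum_smul_le_of_norm_sum_le h hb.le hcA).trans_lt ?_
  rw [mul_div_assoc', div_lt_iff₀ (by positivity)]
  linarith

variable [TopologicalSpace ι] [DiscreteTopology ι]

variable (𝕜) in
/-- The operator `c ↦ ∑ i, c i • x i` on `c₀(ι)` defined by a family with bounded finite partial
sums. -/
noncomputable def zeroAtInftySumCLM {x : ι → E} {M : ℝ}
    (h : ∀ A : Finset ι, ‖∑ i ∈ A, x i‖ ≤ M) : C₀(ι, 𝕜) →L[𝕜] E :=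
  have hsum (c : C₀(ι, 𝕜)) : Summable fun i => c i • x i :=
    summable_smul_of_norm_sum_le h (tendsto_zeroAtInfty_cofinite c)
  LinearMap.mkContinuous
    { toFun := fun c => ∑' i, c i • x i
      map_add' := fun c d => by
        rw [← (hsum c).tsum_add (hsum d)]
        exact tsum_congr fun i => add_smul (c i) (d i) (x i)
      map_smul' := fun a c => by
        rw [RingHom.id_apply, ← (hsum c).tsum_const_smul]
        exact tsum_congr fun i => mul_smul a (c i) (x i) }
    (4 * M) fun c =>
      le_of_tendsto (hsum c).hasSum.norm <| Eventually.of_forall fun _ =>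
        norm_sum_smul_le_of_norm_sum_le h (norm_nonneg c) fun i _ => norm_zeroAtInfty_apply_le c i

theorem hasSum_zeroAtInftySumCLM {x : ι → E} {M : ℝ}
    (h : ∀ A : Finset ι, ‖∑ i ∈ A, x i‖ ≤ M) (c : C₀(ι, 𝕜)) :
    HasSum (fun i => c i • x i) (zeroAtInftySumCLM 𝕜 h c) :=
  (summable_smul_of_norm_sum_le h (tendsto_zeroAtInfty_cofinite c)).hasSum

theorem antilipschitz_zeroAtInftySumCLM {x : ι → E} {M : ℝ}
    (h : ∀ A : Finset ι, ‖∑ i ∈ A, x i‖ ≤ M) {δ : ℝ} (hδ : 0 < δ) {f : ι → E →L[𝕜] 𝕜}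
    (hf : ∀ i, ‖f i‖ ≤ 1) (hdiag : ∀ i, δ ≤ ‖f i (x i)‖)
    (hoff : ∀ i (A : Finset ι), i ∉ A → ∑ j ∈ A, ‖f i (x j)‖ ≤ δ / 2) :
    AntilipschitzWith (2 / δ).toNNReal (zeroAtInftySumCLM 𝕜 h) := by
  have hcoord (c : C₀(ι, 𝕜)) (i : ι) :
      ‖c i‖ ≤ (‖zeroAtInftySumCLM 𝕜 h c‖ + ‖c‖ * (δ / 2)) / δ := by
    have hoffdiag (A : Finset ι) (hi : i ∉ A) : ∑ j ∈ A, ‖f i (c j • x j)‖ ≤ ‖c‖ * (δ / 2) :=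
      calc ∑ j ∈ A, ‖f i (c j • x j)‖ ≤ ∑ j ∈ A, ‖c‖ * ‖f i (x j)‖ :=
            Finset.sum_le_sum fun j _ => by
              rw [map_smul, norm_smul]
              exact mul_le_mul_of_nonneg_right (norm_zeroAtInfty_apply_le c j) (norm_nonneg _)
        _ = ‖c‖ * ∑ j ∈ A, ‖f i (x j)‖ := (Finset.mul_sum _ _ _).symm
        _ ≤ ‖c‖ * (δ / 2) := mul_le_mul_of_nonneg_left (hoff i A hi) (norm_nonneg c)
    rw [le_div_iff₀ hδ]
    calc ‖c i‖ * δ ≤ ‖c i‖ * ‖f i (x i)‖ := mul_le_mul_of_nonneg_left (hdiag i) (norm_nonneg _)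
      _ = ‖f i (c i • x i)‖ := by rw [map_smul, norm_smul]
      _ ≤ ‖f i (zeroAtInftySumCLM 𝕜 h c)‖ + ‖c‖ * (δ / 2) :=
          norm_le_norm_add_of_hasSum ((f i).hasSum (hasSum_zeroAtInftySumCLM h c)) hoffdiag
      _ ≤ ‖zeroAtInftySumCLM 𝕜 h c‖ + ‖c‖ * (δ / 2) := by
          gcongr
          simpa using (f i).le_of_opNorm_le (hf i) (zeroAtInftySumCLM 𝕜 h c)
  refine AddMonoidHomClass.antilipschitz_of_bound _ fun c => ?_
  have hc := norm_zeroAtInfty_le (by positivity) (hcoord c)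
  rw [le_div_iff₀ hδ] at hc
  rw [Real.coe_toNNReal _ (by positivity), div_mul_eq_mul_div, le_div_iff₀ hδ]
  linarith

end BessagaPelczynski

/-- Bessaga–Pełczyński -/
theorem containsCopyOfC0_of_norm_sum_le {E : Type*} [NormedAddCommGroup E] [NormedSpace ℂ E]
    [CompleteSpace E] {x : ℕ → E} {M δ : ℝ} (hδ : 0 < δ) (hx : ∀ i, δ ≤ ‖x i‖)
    (h : ∀ A : Finset ℕ, ‖∑ i ∈ A, x i‖ ≤ M) : ContainsCopyOfC0 E := by
  choose f hf hfx using fun i => exists_dual_vector'' ℂ (x i)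
  obtain ⟨r, hr⟩ := exists_nat_ge (4 * M / (δ / 2))
  rw [div_le_iff₀ (by positivity)] at hr
  obtain ⟨σ, hσ, hoff⟩ := exists_injective_sum_le_of_sum_le (half_pos hδ).le r
    (fun i j => ‖f i (x j)‖) fun i A => (sum_norm_apply_le_of_norm_sum_le h (hf i) A).trans hr
  have hsub (A : Finset ℕ) : ‖∑ i ∈ A, x (σ i)‖ ≤ M := by
    simpa only [Finset.sum_map, Function.Embedding.coeFn_mk] using h (A.map ⟨σ, hσ⟩)
  have hdiag (i : ℕ) : δ ≤ ‖f (σ i) (x (σ i))‖ := by simpa [hfx] using hx (σ i)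
  let J := zeroAtInftySumCLM ℂ hsub
  have hJ : AntilipschitzWith (2 / δ).toNNReal J :=
    antilipschitz_zeroAtInftySumCLM hsub hδ (fun i => hf (σ i)) hdiag hoff
  exact ⟨_, ⟨J.equivRange hJ.injective (hJ.isClosed_range J.uniformContinuous)⟩⟩

section Orbits

variable {𝕜 E F : Type*} [NontriviallyNormedField 𝕜] [NormedAddCommGroup E] [NormedSpace 𝕜 E]
  [NormedAddCommGroup F] [NormedSpace 𝕜 F]

/-- Relative compactness of the single orbit `{T ^ n x}`; `HasRelCompactOrbitsOn T A` is this
property for all `x ∈ A`. -/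
def HasRelCompactOrbit (T : E →L[𝕜] E) (x : E) : Prop :=
  IsCompact (closure (Set.range fun n : ℕ => (T ^ n) x))

theorem hasRelCompactOrbit_of_forall_mem {T : E →L[𝕜] E} {x : E} {K : Set E} (hK : IsCompact K)
    (h : ∀ n, (T ^ n) x ∈ K) : HasRelCompactOrbit T x :=
  hK.closure_of_subset (Set.range_subset_iff.2 h)

namespace HasRelCompactOrbit

theorem map {T : E →L[𝕜] E} {S : F →L[𝕜] F} {A : E →L[𝕜] F} (hA : Function.Semiconj A T S)
    {x : E} (h : HasRelCompactOrbit T x) : HasRelCompactOrbit S (A x) :=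
  hasRelCompactOrbit_of_forall_mem (h.image A.continuous) fun n =>
    ⟨(T ^ n) x, subset_closure ⟨n, rfl⟩, by
      simpa only [FunLike.coe_pow_eq_iterate] using hA.iterate_right n x⟩

theorem pow {T : E →L[𝕜] E} {x : E} (h : HasRelCompactOrbit T x) (m : ℕ) :
    HasRelCompactOrbit (T ^ m) x :=
  hasRelCompactOrbit_of_forall_mem h fun n => subset_closure ⟨m * n, by simp only [pow_mul]⟩

theorem of_pow {T : E →L[𝕜] E} {x : E} {m : ℕ} (hm : 1 ≤ m) (h : HasRelCompactOrbit (T ^ m) x) :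
    HasRelCompactOrbit T x := by
  refine hasRelCompactOrbit_of_forall_mem ((Finset.range m).isCompact_biUnion fun r _ =>
    IsCompact.image h (T ^ r).continuous) fun n => ?_
  refine Set.mem_biUnion (Finset.mem_range.2 (Nat.mod_lt n hm))
    ⟨((T ^ m) ^ (n / m)) x, subset_closure ⟨n / m, rfl⟩, ?_⟩
  rw [← mul_apply_eq_comp, ← pow_mul, ← pow_add, Nat.mod_add_div]

end HasRelCompactOrbit

theorem norm_pow_apply_sub_le {T : E →L[𝕜] E} {C : ℝ} (hC : ∀ n, ‖T ^ n‖ ≤ C) (n : ℕ) (z : E) :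
    ‖(T ^ n) z - z‖ ≤ n * (C * ‖T z - z‖) := by
  have hgeom : (T ^ n) z - z = ∑ i ∈ Finset.range n, (T ^ i) (T z - z) := by
    simpa [mul_apply_eq_comp] using (DFunLike.congr_fun (geom_sum_mul T n) z).symm
  rw [hgeom]
  calc ‖∑ i ∈ Finset.range n, (T ^ i) (T z - z)‖
      ≤ ∑ _ ∈ Finset.range n, C * ‖T z - z‖ :=
        norm_sum_le_of_le _ fun _ _ => (T ^ _).le_of_opNorm_le (hC _) _
    _ = n * (C * ‖T z - z‖) := by rw [Finset.sum_const, Finset.card_range, nsmul_eq_mul]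

theorem norm_sum_pow_apply_sub_le {T : E →L[𝕜] E} {x : E} {τ : ℕ → ℕ} {ε : ℕ → ℝ}
    (h : ∀ n, ∀ t ≤ ∑ i ∈ Finset.range n, τ i,
      ‖(T ^ t) ((T ^ τ n) x - x) - ((T ^ τ n) x - x)‖ ≤ ε n) (A : Finset ℕ) :
    ‖∑ i ∈ A, ((T ^ τ i) x - x) - ((T ^ ∑ i ∈ A, τ i) x - x)‖ ≤ ∑ i ∈ A, ε i := by
  induction A using Finset.induction_on_max with
  | empty => simp
  | insert n A hlt ih =>
    have hn : n ∉ A := fun hmem => (hlt n hmem).false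
    set t := ∑ i ∈ A, τ i with ht_def
    have ht : t ≤ ∑ i ∈ Finset.range n, τ i :=
      Finset.sum_le_sum_of_subset fun i hi => Finset.mem_range.2 (hlt i hi)
    rw [Finset.sum_insert hn, Finset.sum_insert hn, Finset.sum_insert hn, ← ht_def, add_comm (τ n),
      pow_add, mul_apply_eq_comp]
    calc _ = ‖-((T ^ t) ((T ^ τ n) x - x) - ((T ^ τ n) x - x)) +
            (∑ i ∈ A, ((T ^ τ i) x - x) - ((T ^ t) x - x))‖ := by
          rw [map_sub]; congr 1; abel
      _ ≤ ε n + ∑ i ∈ A, ε i := norm_add_le_of_le ((norm_neg _).trans_le (h n t ht)) ih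

end Orbits

theorem exists_seq_forall_sum_range {P : ℕ → ℕ → ℕ → Prop} (h : ∀ n s, ∃ k, P n s k) :
    ∃ τ : ℕ → ℕ, ∀ n, P n (∑ i ∈ Finset.range n, τ i) (τ n) := by
  choose f hf using h
  let S : ℕ → ℕ := Nat.rec 0 fun n s => s + f n s
  have hS (n : ℕ) : ∑ i ∈ Finset.range n, f i (S i) = S n := by
    induction n with
    | zero => rfl
    | succ n ih => rw [Finset.sum_range_succ, ih]
  exact ⟨fun n => f n (S n), fun n => by rw [hS]; exact hf n (S n)⟩

theorem totallyBounded_range_of_dist_lt {ι X Y : Type*} [PseudoMetricSpace X]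
    [PseudoMetricSpace Y] {f : ι → X} {g : ι → Y} (hf : TotallyBounded (Set.range f))
    (h : ∀ ε > 0, ∃ δ > 0, ∀ i j, dist (f i) (f j) < δ → dist (g i) (g j) < ε) :
    TotallyBounded (Set.range g) := by
  rw [Metric.totallyBounded_iff]
  intro ε hε
  obtain ⟨δ, hδ, hfg⟩ := h ε hε
  have hfinite := Metric.finite_approx_of_totallyBounded hf δ hδ
  rw [← Set.image_univ, Set.exists_subset_image_finite_and] at hfinite
  obtain ⟨t, -, htfin, hcover⟩ := hfinite
  refine ⟨g '' t, htfin.image g, Set.range_subset_iff.2 fun j => ?_⟩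
  obtain ⟨_, ⟨i, hit, rfl⟩, hji⟩ := Set.mem_iUnion₂.1 (hcover (Set.mem_image_of_mem f trivial))
  exact Set.mem_biUnion (Set.mem_image_of_mem g hit) (hfg j i hji)

section PowerBounded

variable {E : Type*} [NormedAddCommGroup E] [NormedSpace ℂ E] {T : E →L[ℂ] E}

theorem IsPowerBounded.pow (hT : IsPowerBounded T) (m : ℕ) : IsPowerBounded (T ^ m) :=
  let ⟨C, hC⟩ := hT
  ⟨C, fun n => by rw [← pow_mul]; exact hC _⟩

theorem bddBelow_range_norm_pow_apply (T : E →L[ℂ] E) (x : E) :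
    BddBelow (Set.range fun n : ℕ => ‖(T ^ n) x‖) :=
  ⟨0, Set.forall_mem_range.2 fun _ => norm_nonneg _⟩

theorem IsPowerBoundedBelow.pow (hT : IsPowerBoundedBelow T) (m : ℕ) :
    IsPowerBoundedBelow (T ^ m) := fun x hx =>
  (hT x hx).trans_le <| le_ciInf fun n => by
    rw [← pow_mul]
    exact ciInf_le (bddBelow_range_norm_pow_apply T x) (m * n)

theorem IsDoublyPowerBounded.isPowerBounded (hT : IsDoublyPowerBounded T) : IsPowerBounded T := by
  obtain ⟨U, rfl, hU, -⟩ := hT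
  exact hU

theorem IsDoublyPowerBounded.isPowerBoundedBelow (hT : IsDoublyPowerBounded T) :
    IsPowerBoundedBelow T := by
  obtain ⟨U, rfl, -, C, hC⟩ := hT
  intro x hx
  have hle (n : ℕ) : ‖x‖ ≤ C * ‖((U : E →L[ℂ] E) ^ n) x‖ := by
    have hinv : (↑U⁻¹ : E →L[ℂ] E) ^ n * (U : E →L[ℂ] E) ^ n = 1 := pow_mul_pow_eq_one n U.inv_mul
    have hle := ((↑U⁻¹ : E →L[ℂ] E) ^ n).le_of_opNorm_le (hC n) (((U : E →L[ℂ] E) ^ n) x)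
    rwa [← mul_apply_eq_comp, hinv, one_apply_eq_self] at hle
  have hx' : 0 < ‖x‖ := norm_pos_iff.2 hx
  have hC0 : 0 < C := pos_of_mul_pos_left (hx'.trans_le (hle 0)) (norm_nonneg _)
  exact (div_pos hx' hC0).trans_le <| le_ciInf fun n => (div_le_iff₀' hC0).2 (hle n)

theorem IsPowerBounded.continuous_iInf_norm_pow_apply (hT : IsPowerBounded T) :
    Continuous fun x => ⨅ n : ℕ, ‖(T ^ n) x‖ := by
  obtain ⟨C, hC⟩ := hT
  refine (LipschitzWith.of_le_add_mul' C fun x y => ?_).continuous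
  rw [← sub_le_iff_le_add]
  refine le_ciInf fun n => ?_
  rw [sub_le_iff_le_add, dist_eq_norm]
  calc ⨅ n : ℕ, ‖(T ^ n) x‖ ≤ ‖(T ^ n) x‖ := ciInf_le (bddBelow_range_norm_pow_apply T x) n
    _ ≤ ‖(T ^ n) y‖ + ‖(T ^ n) (x - y)‖ := by
        rw [map_sub]; exact norm_le_norm_add_norm_sub' _ _
    _ ≤ ‖(T ^ n) y‖ + C * ‖x - y‖ := by gcongr; exact (T ^ n).le_of_opNorm_le (hC n) _

theorem exists_pos_forall_le_norm_pow_apply (hT : IsPowerBounded T) (hbelow : IsPowerBoundedBelow T)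
    {K : Set E} (hK : IsCompact K) {ε : ℝ} (hε : 0 < ε) :
    ∃ η > 0, ∀ x ∈ K, ε ≤ ‖x‖ → ∀ n, η ≤ ‖(T ^ n) x‖ := by
  have hL : IsCompact (K ∩ {x | ε ≤ ‖x‖}) :=
    hK.inter_right (isClosed_le continuous_const continuous_norm)
  rcases (K ∩ {x | ε ≤ ‖x‖}).eq_empty_or_nonempty with hempty | hne
  · exact ⟨1, one_pos, fun x hx hεx => (Set.eq_empty_iff_forall_notMem.1 hempty x ⟨hx, hεx⟩).elim⟩
  · obtain ⟨x₀, ⟨-, hx₀⟩, hmin⟩ :=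
      hL.exists_isMinOn hne hT.continuous_iInf_norm_pow_apply.continuousOn
    exact ⟨_, hbelow x₀ (norm_pos_iff.1 (hε.trans_le hx₀)), fun x hx hεx n =>
      (hmin ⟨hx, hεx⟩).trans (ciInf_le (bddBelow_range_norm_pow_apply T x) n)⟩

theorem HasRelCompactOrbit.exists_pos_norm_pow_apply_sub_lt (hT : IsPowerBounded T)
    (hbelow : IsPowerBoundedBelow T) {y : E} (hy : HasRelCompactOrbit T y) {ε : ℝ} (hε : 0 < ε) :
    ∃ η > 0, ∀ m k, ‖(T ^ (m + k)) y - (T ^ m) y‖ < η → ‖(T ^ k) y - y‖ < ε := by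
  obtain ⟨η, hη, h⟩ := exists_pos_forall_le_norm_pow_apply hT hbelow
    (IsCompact.image hy (continuous_id.sub continuous_const : Continuous fun z => z - y)) hε
  refine ⟨η, hη, fun m k hmk => lt_of_not_ge fun hk => hmk.not_ge ?_⟩
  rw [pow_add, mul_apply_eq_comp, ← map_sub]
  exact h _ ⟨(T ^ k) y, subset_closure ⟨k, rfl⟩, rfl⟩ hk m

variable [CompleteSpace E]

theorem exists_nat_pos_norm_pow_apply_sub_lt (hE : ¬ ContainsCopyOfC0 E) (hT : IsPowerBounded T)
    (x : E) {δ : ℝ} (hδ : 0 < δ) :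
    ∃ s : ℕ, ∃ ε > 0, ∀ k,
      (∀ t ≤ s, ‖(T ^ t) ((T ^ k) x - x) - ((T ^ k) x - x)‖ ≤ ε) → ‖(T ^ k) x - x‖ < δ := by
  by_contra! hcon
  -- Almost periods `τ n` chosen one after the other make the finite sums of `T ^ τ n x - x`
  -- differ from a single `T ^ t x - x` by a bounded amount.
  obtain ⟨τ, hτ⟩ := exists_seq_forall_sum_range fun n s => hcon s ((1 / 2) ^ n) (by positivity)
  obtain ⟨C, hC⟩ := hT
  refine hE (containsCopyOfC0_of_norm_sum_le (M := C * ‖x‖ + ‖x‖ + 2) hδ (fun n => (hτ n).2)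
    fun A => ?_)
  have hsum := (norm_sum_pow_apply_sub_le (fun n => (hτ n).1) A).trans
    ((summable_geometric_two.sum_le_tsum A fun _ _ => by positivity).trans_eq tsum_geometric_two)
  calc _ ≤ ‖(T ^ ∑ i ∈ A, τ i) x - x‖ + 2 :=
        (norm_le_norm_add_norm_sub' _ _).trans (add_le_add_right hsum _)
    _ ≤ C * ‖x‖ + ‖x‖ + 2 := by
        gcongr
        exact norm_sub_le_of_le ((T ^ _).le_of_opNorm_le (hC _) x) le_rfl

theorem exists_pos_norm_pow_apply_sub_lt (hE : ¬ ContainsCopyOfC0 E) (hT : IsPowerBounded T)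
    (x : E) {δ : ℝ} (hδ : 0 < δ) :
    ∃ ε > 0, ∀ k, ‖(T ^ k) (T x - x) - (T x - x)‖ < ε → ‖(T ^ k) x - x‖ < δ := by
  obtain ⟨s, ε, hε, h⟩ := exists_nat_pos_norm_pow_apply_sub_lt hE hT x hδ
  obtain ⟨C, hC⟩ := hT
  have hC0 : 0 ≤ C := (norm_nonneg _).trans (hC 0)
  refine ⟨ε / (s * C + 1), by positivity, fun k hk => h k fun t ht => ?_⟩
  rw [lt_div_iff₀ (by positivity)] at hk
  set z := (T ^ k) x - x with hz
  have hcomm : T z - z = (T ^ k) (T x - x) - (T x - x) := by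
    rw [hz, map_sub, map_sub, ← mul_apply_eq_comp, ← mul_apply_eq_comp, ← pow_succ, ← pow_succ']
    abel
  calc ‖(T ^ t) z - z‖ ≤ t * (C * ‖T z - z‖) := norm_pow_apply_sub_le hC t z
    _ ≤ s * (C * ‖T z - z‖) := by gcongr
    _ ≤ ε := by rw [hcomm]; linarith [norm_nonneg ((T ^ k) (T x - x) - (T x - x))]

/-- Discrete Bohl–Bohr–Kadets theorem. -/
theorem hasRelCompactOrbit_of_apply_sub (hE : ¬ ContainsCopyOfC0 E) (hT : IsPowerBounded T)
    (hbelow : IsPowerBoundedBelow T) {x : E} (hx : HasRelCompactOrbit T (T x - x)) :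
    HasRelCompactOrbit T x := by
  have htb : TotallyBounded (Set.range fun n : ℕ => (T ^ n) x) := by
    refine totallyBounded_range_of_dist_lt (hx.totallyBounded.subset subset_closure) fun ε hε => ?_
    obtain ⟨C, hC⟩ := hT
    have hC0 : 0 ≤ C := (norm_nonneg _).trans (hC 0)
    obtain ⟨δ, hδ, hxδ⟩ := exists_pos_norm_pow_apply_sub_lt hE ⟨C, hC⟩ x
      (show 0 < ε / (C + 1) by positivity)
    obtain ⟨η, hη, hyη⟩ := hx.exists_pos_norm_pow_apply_sub_lt ⟨C, hC⟩ hbelow hδ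
    refine ⟨η, hη, fun i j hij => ?_⟩
    wlog hle : j ≤ i generalizing i j
    · rw [dist_comm] at hij ⊢
      exact this j i hij (le_of_not_ge hle)
    obtain ⟨k, rfl⟩ := Nat.exists_eq_add_of_le hle
    rw [dist_eq_norm] at hij ⊢
    have hk := hxδ k (hyη j k hij)
    rw [lt_div_iff₀ (by positivity)] at hk
    calc ‖(T ^ (j + k)) x - (T ^ j) x‖ = ‖(T ^ j) ((T ^ k) x - x)‖ := by
          rw [pow_add, mul_apply_eq_comp, map_sub]
      _ ≤ C * ‖(T ^ k) x - x‖ := (T ^ j).le_of_opNorm_le (hC j) _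
      _ < ε := by linarith [norm_nonneg ((T ^ k) x - x)]
  exact htb.closure.isCompact_of_isClosed isClosed_closure

theorem someIffEachRelCompactOrbits_of_not_containsCopyOfC0 (hE : ¬ ContainsCopyOfC0 E)
    (hT : IsPowerBounded T) (hbelow : IsPowerBoundedBelow T) : SomeIffEachRelCompactOrbits T := by
  refine ⟨fun ⟨m, hm, hcompact⟩ k _ => ?_, fun h => ⟨1, le_rfl, h 1 le_rfl⟩⟩
  rintro _ ⟨x, rfl⟩
  have hdiff : HasRelCompactOrbit (T ^ m) ((T ^ m) x - x) :=
    HasRelCompactOrbit.pow (hcompact _ ⟨-x, by simp [neg_add_eq_sub]⟩) m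
  have hx : HasRelCompactOrbit T x :=
    (hasRelCompactOrbit_of_apply_sub hE (hT.pow m) (hbelow.pow m) hdiff).of_pow hm
  have hcomm : Function.Semiconj (1 - T ^ k : E →L[ℂ] E) T T :=
    DFunLike.congr_fun ((Commute.one_left T).sub_left (Commute.pow_self T k)).eq
  exact hx.map hcomm

end PowerBounded

theorem exists_tendsto_dist_zero_of_forall_mapClusterPt_mem {ι X : Type*} [PseudoMetricSpace X]
    [CompactSpace X] {l : Filter ι} {f : ι → X} {W : Set X} (hW : IsClosed W) (hne : W.Nonempty)
    (h : ∀ x, MapClusterPt x l f → x ∈ W) :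
    ∃ g : ι → X, (∀ i, g i ∈ W) ∧ Tendsto (fun i => dist (f i) (g i)) l (𝓝 0) := by
  choose g hgW hfg using fun i => hW.isCompact.exists_infDist_eq_dist hne (f i)
  refine ⟨g, hgW, ?_⟩
  simp only [← hfg]
  refine Metric.tendsto_nhds.2 fun ε hε => ?_
  simp only [Real.dist_0_eq_abs, abs_of_nonneg Metric.infDist_nonneg]
  by_contra hfreq
  have hclosed : IsClosed {x | ε ≤ Metric.infDist x W} :=
    isClosed_le continuous_const (Metric.continuous_infDist_pt W)
  obtain ⟨x, hx, hxf⟩ := hclosed.isCompact.exists_mapClusterPt_of_frequently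
    ((not_eventually.1 hfreq).mono fun i => le_of_not_gt)
  exact (hε.trans_le hx).ne' (Metric.infDist_zero_of_mem (h x hxf))

section Sobczyk

open TopologicalSpace (SeparableSpace)

variable {ι 𝕜 E : Type*} [RCLike 𝕜] [NormedAddCommGroup E] [NormedSpace 𝕜 E]

theorem exists_annihilator_tendsto_sub [SeparableSpace E] {l : Filter ι}
    {F : Submodule 𝕜 E} {f : ι → E →L[𝕜] 𝕜} {M : ℝ} (hM0 : 0 ≤ M) (hM : ∀ i, ‖f i‖ ≤ M)
    (hf : ∀ v ∈ F, Tendsto (fun i => f i v) l (𝓝 0)) :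
    ∃ g : ι → E →L[𝕜] 𝕜, (∀ i, ‖g i‖ ≤ M) ∧ (∀ i, ∀ v ∈ F, g i v = 0) ∧
      ∀ x, Tendsto (fun i => f i x - g i x) l (𝓝 0) := by
  let K : Set (WeakDual 𝕜 E) := WeakDual.toStrongDual ⁻¹' Metric.closedBall 0 M
  have hK : IsCompact K := WeakDual.isCompact_closedBall 0 M
  have : CompactSpace K := isCompact_iff_compactSpace.1 hK
  have := WeakDual.metrizable_of_isCompact 𝕜 E K hK
  let _ := TopologicalSpace.metrizableSpaceMetric K
  have heval (x : E) : Continuous fun k : K => (k : WeakDual 𝕜 E) x :=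
    (WeakDual.eval_continuous x).comp continuous_subtype_val
  let fK (i : ι) : K := ⟨StrongDual.toWeakDual (f i), mem_closedBall_zero_iff.2 (hM i)⟩
  let W : Set K := {k | ∀ v ∈ F, (k : WeakDual 𝕜 E) v = 0}
  have hW : IsClosed W := by
    simp only [W, Set.ofPred_forall]
    exact isClosed_biInter fun v _ => isClosed_eq (heval v) continuous_const
  have hcluster (k : K) (hk : MapClusterPt k l fK) : k ∈ W := fun v hv =>
    haveI : NeBot (𝓝 ((k : WeakDual 𝕜 E) v) ⊓ map (fun i => f i v) l) :=
      hk.continuousAt_comp (heval v).continuousAt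
    eq_of_nhds_neBot (this.mono (inf_le_inf_left _ (hf v hv)))
  obtain ⟨g, hgW, hfg⟩ := exists_tendsto_dist_zero_of_forall_mapClusterPt_mem hW
    ⟨⟨0, mem_closedBall_zero_iff.2 (norm_zero.trans_le hM0)⟩, fun v _ => rfl⟩ hcluster
  refine ⟨fun i => WeakDual.toStrongDual (g i : WeakDual 𝕜 E),
    fun i => mem_closedBall_zero_iff.1 (g i).2, hgW, fun x => ?_⟩
  have huc := CompactSpace.uniformContinuous_of_continuous (heval x)
  have hdist := tendsto_uniformity_iff_dist_tendsto_zero.1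
    (Tendsto.comp huc
      (tendsto_uniformity_iff_dist_tendsto_zero (f := fun i => (fK i, g i)).2 hfg))
  simp only [Function.comp_apply, dist_eq_norm] at hdist
  exact tendsto_zero_iff_norm_tendsto_zero.2 hdist

/-- Sobczyk's theorem. -/
theorem exists_extension_zeroAtInfty [SeparableSpace E] [TopologicalSpace ι] [DiscreteTopology ι]
    {F : Submodule 𝕜 E} (T : F →L[𝕜] C₀(ι, 𝕜)) :
    ∃ S : E →L[𝕜] C₀(ι, 𝕜), ∀ v : F, S v = T v := by
  choose f hfT hfnorm using fun i => exists_extension_norm_eq F ((zeroAtInftyEvalCLM 𝕜 i).comp T)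
  have hM (i : ι) : ‖f i‖ ≤ ‖T‖₊ := by
    rw [hfnorm]
    exact (ContinuousLinearMap.opNorm_comp_le _ _).trans
      (mul_le_of_le_one_left (norm_nonneg T) (norm_zeroAtInftyEvalCLM_le i))
  have hf : ∀ v ∈ F, Tendsto (fun i => f i v) cofinite (𝓝 0) := fun v hv =>
    (tendsto_zeroAtInfty_cofinite (T ⟨v, hv⟩)).congr fun i => (hfT i ⟨v, hv⟩).symm
  obtain ⟨g, hgM, hgF, hfg⟩ := exists_annihilator_tendsto_sub (norm_nonneg T) hM hf
  refine ⟨toZeroAtInftyCLM (fun i => f i - g i) (‖T‖₊ + ‖T‖₊)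
    (fun i => ?_) hfg, fun v => ?_⟩
  · rw [NNReal.coe_add]
    exact norm_sub_le_of_le (hM i) (hgM i)
  · ext i
    rw [toZeroAtInftyCLM_apply, sub_apply, hgF i v v.2, sub_zero, hfT,
      ContinuousLinearMap.comp_apply, zeroAtInftyEvalCLM_apply]

theorem ContainsCopyOfC0.exists_hasLeftInverse {E : Type*} [NormedAddCommGroup E] [NormedSpace ℂ E]
    [SeparableSpace E] (hE : ContainsCopyOfC0 E) :
    ∃ J : C₀(ℕ, ℂ) →L[ℂ] E, J.HasLeftInverse := by
  obtain ⟨F, ⟨e⟩⟩ := hE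
  obtain ⟨P, hP⟩ := exists_extension_zeroAtInfty (e.symm : F →L[ℂ] C₀(ℕ, ℂ))
  exact ⟨F.subtypeL.comp (e : C₀(ℕ, ℂ) →L[ℂ] F), P,
    fun c => (hP (e c)).trans (e.symm_apply_apply c)⟩

end Sobczyk

section ExtendById

variable {𝕜 E G : Type*} [NontriviallyNormedField 𝕜] [NormedAddCommGroup E] [NormedSpace 𝕜 E]
  [NormedAddCommGroup G] [NormedSpace 𝕜 G]

/-- If `P` is a left inverse of `J`, then `E` is the direct sum of the copy `J G` of `G` and of
`ker P`; an operator `T` on `G` extends to `E` by acting as `T` on the first summand and as the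
identity on the second. -/
def extendById {J : G →L[𝕜] E} {P : E →L[𝕜] G} (hPJ : Function.LeftInverse P J) :
    (G →L[𝕜] G) →* (E →L[𝕜] E) where
  toFun T := 1 + J ∘L (T - 1) ∘L P
  map_one' := by simp
  map_mul' S T := by
    ext x
    simp [mul_apply_eq_comp, hPJ.eq]
    abel

variable {J : G →L[𝕜] E} {P : E →L[𝕜] G} (hPJ : Function.LeftInverse P J)

theorem extendById_apply (T : G →L[𝕜] G) (x : E) :
    extendById hPJ T x = x + J (T (P x) - P x) := rfl

theorem semiconj_extendById (T : G →L[𝕜] G) :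
    Function.Semiconj J T (extendById hPJ T) := fun c => by
  rw [extendById_apply, hPJ, map_sub, add_sub_cancel]

theorem semiconj_leftInverse_extendById (T : G →L[𝕜] G) :
    Function.Semiconj P (extendById hPJ T) T := fun x => by
  rw [extendById_apply, map_add, hPJ, add_sub_cancel]

theorem norm_extendById_le (T : G →L[𝕜] G) :
    ‖extendById hPJ T‖ ≤ 1 + ‖J‖ * ((‖T‖ + 1) * ‖P‖) := by
  refine norm_add_le_of_le ContinuousLinearMap.norm_id_le ?_
  calc ‖J ∘L (T - 1) ∘L P‖ ≤ ‖J‖ * (‖T - 1‖ * ‖P‖) :=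
        (ContinuousLinearMap.opNorm_comp_le _ _).trans
          (mul_le_mul_of_nonneg_left (ContinuousLinearMap.opNorm_comp_le _ _) (norm_nonneg J))
    _ ≤ ‖J‖ * ((‖T‖ + 1) * ‖P‖) := by
        gcongr
        exact norm_sub_le_of_le le_rfl ContinuousLinearMap.norm_id_le

end ExtendById

section Transfer

variable {E G : Type*} [NormedAddCommGroup E] [NormedSpace ℂ E] [NormedAddCommGroup G]
  [NormedSpace ℂ G] {J : G →L[ℂ] E} {P : E →L[ℂ] G} (hPJ : Function.LeftInverse P J)
  {T : G →L[ℂ] G}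

theorem IsPowerBounded.extendById (hT : IsPowerBounded T) : IsPowerBounded (extendById hPJ T) := by
  obtain ⟨C, hC⟩ := hT
  refine ⟨1 + ‖J‖ * ((C + 1) * ‖P‖), fun n => ?_⟩
  rw [← map_pow]
  exact (norm_extendById_le hPJ _).trans (by gcongr; exact hC n)

theorem IsDoublyPowerBounded.extendById (hT : IsDoublyPowerBounded T) :
    IsDoublyPowerBounded (extendById hPJ T) := by
  obtain ⟨U, rfl, hU, hUinv⟩ := hT
  exact ⟨Units.map (_root_.extendById hPJ) U, rfl, hU.extendById hPJ, hUinv.extendById hPJ⟩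

theorem hasRelCompactOrbitsOn_extendById_iff (m : ℕ) :
    HasRelCompactOrbitsOn (extendById hPJ T) (Set.range (1 - extendById hPJ T ^ m : E →L[ℂ] E)) ↔
      HasRelCompactOrbitsOn T (Set.range (1 - T ^ m : G →L[ℂ] G)) := by
  rw [← map_pow]
  constructor
  · rintro h _ ⟨c, rfl⟩
    have hJ : HasRelCompactOrbit (extendById hPJ T) (J ((1 - T ^ m) c)) :=
      h _ ⟨J c, by
        simp only [sub_apply, one_apply_eq_self, extendById_apply, hPJ.eq, map_sub]
        abel⟩
    rw [← hPJ ((1 - T ^ m) c)]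
    exact hJ.map (semiconj_leftInverse_extendById hPJ T)
  · rintro h _ ⟨x, rfl⟩
    have hP : HasRelCompactOrbit T ((1 - T ^ m) (P x)) := h _ ⟨P x, rfl⟩
    have hx : (1 - extendById hPJ (T ^ m)) x = J ((1 - T ^ m) (P x)) := by
      simp only [sub_apply, one_apply_eq_self, extendById_apply, map_sub]
      abel
    rw [hx]
    exact hP.map (semiconj_extendById hPJ T)

theorem someIffEachRelCompactOrbits_of_hasLeftInverse (hJ : J.HasLeftInverse)
    (hE : ∀ S : E →L[ℂ] E, IsDoublyPowerBounded S → SomeIffEachRelCompactOrbits S)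
    (hT : IsDoublyPowerBounded T) : SomeIffEachRelCompactOrbits T := by
  obtain ⟨P, hPJ⟩ := hJ
  simpa only [SomeIffEachRelCompactOrbits, hasRelCompactOrbitsOn_extendById_iff] using
    hE _ (hT.extendById hPJ)

end Transfer

section OnePoint

variable (𝕜 : Type*) [NontriviallyNormedField 𝕜]

theorem norm_continuousMapEvalCLM_le {X : Type*} [TopologicalSpace X] [CompactSpace X] (x : X) :
    ‖(ContinuousMap.evalCLM 𝕜 x : C(X, 𝕜) →L[𝕜] 𝕜)‖ ≤ 1 :=
  ContinuousLinearMap.opNorm_le_bound _ zero_le_one fun f =>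
    (f.norm_coe_le_norm x).trans_eq (one_mul _).symm

/-- The coordinates of a convergent sequence in `c₀`: its limit, followed by the deviations of its
terms from the limit. This is the classical isomorphism of `c` and `c₀`. -/
noncomputable def onePointToZeroAtInftyCLM : C(OnePoint ℕ, 𝕜) →L[𝕜] C₀(ℕ, 𝕜) :=
  toZeroAtInftyCLM
    (fun
      | 0 => ContinuousMap.evalCLM 𝕜 ∞
      | n + 1 => ContinuousMap.evalCLM 𝕜 (n : OnePoint ℕ) - ContinuousMap.evalCLM 𝕜 ∞)
    2
    (by
      rintro (_ | n)
      · exact (norm_continuousMapEvalCLM_le 𝕜 _).trans one_le_two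
      · exact (norm_sub_le_of_le (norm_continuousMapEvalCLM_le 𝕜 _)
          (norm_continuousMapEvalCLM_le 𝕜 _)).trans_eq one_add_one_eq_two)
    fun f => by
      rw [Nat.cofinite_eq_atTop, ← tendsto_add_atTop_iff_nat 1]
      exact tendsto_sub_nhds_zero_iff.2 ((OnePoint.continuous_iff_from_nat f).1 f.continuous)

theorem hasLeftInverse_onePointToZeroAtInftyCLM :
    (onePointToZeroAtInftyCLM 𝕜).HasLeftInverse := by
  have htendsto (y : C₀(ℕ, 𝕜)) : Tendsto (fun n => y (n + 1) + y 0) atTop (𝓝 (y 0)) := by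
    have hy := tendsto_zeroAtInfty_cofinite y
    rw [Nat.cofinite_eq_atTop, ← tendsto_add_atTop_iff_nat 1] at hy
    simpa only [zero_add] using hy.add_const (y 0)
  let P : C₀(ℕ, 𝕜) →L[𝕜] C(OnePoint ℕ, 𝕜) :=
    LinearMap.mkContinuous
      { toFun := fun y => OnePoint.continuousMapMkNat (fun n => y (n + 1) + y 0) (y 0) (htendsto y)
        map_add' := fun y z => by
          ext (_ | n)
          · rfl
          · exact add_add_add_comm _ _ _ _
        map_smul' := fun a y => by
          ext (_ | n)
          · rfl
          · exact (mul_add _ _ _).symm }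
      2 fun y => (ContinuousMap.norm_le _ (by positivity)).2 <| by
        rintro (_ | n)
        · exact (norm_zeroAtInfty_apply_le y 0).trans
            (le_mul_of_one_le_left (norm_nonneg y) one_le_two)
        · exact (norm_add_le_of_le (norm_zeroAtInfty_apply_le y (n + 1))
            (norm_zeroAtInfty_apply_le y 0)).trans_eq (two_mul _).symm
  refine ⟨P, fun f => ?_⟩
  ext (_ | n)
  · rfl
  · exact sub_add_cancel _ _

end OnePoint

section Isometries

variable {E : Type*} [NormedAddCommGroup E] [NormedSpace ℂ E]

theorem isPowerBounded_of_norm_le_one {T : E →L[ℂ] E} (hT : ‖T‖ ≤ 1) : IsPowerBounded T :=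
  ⟨1, fun
    | 0 => ContinuousLinearMap.norm_id_le
    | n + 1 => (norm_pow_le' T n.succ_pos).trans (pow_le_one₀ (norm_nonneg T) hT)⟩

theorem isDoublyPowerBounded_linearIsometryEquiv (U : E ≃ₗᵢ[ℂ] E) :
    IsDoublyPowerBounded (U.toContinuousLinearEquiv : E →L[ℂ] E) :=
  ⟨(ContinuousLinearEquiv.unitsEquiv ℂ E).symm U.toContinuousLinearEquiv, rfl,
    isPowerBounded_of_norm_le_one U.toLinearIsometry.norm_toContinuousLinearMap_le,
    isPowerBounded_of_norm_le_one U.symm.toLinearIsometry.norm_toContinuousLinearMap_le⟩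

end Isometries

section AlmostPeriods

variable {𝕜 E : Type*} [NontriviallyNormedField 𝕜] [NormedAddCommGroup E] [NormedSpace 𝕜 E]
  {T : E →L[𝕜] E} {x : E}

theorem hasRelCompactOrbit_of_forall_norm_pow_sub_pow_mod_lt [CompleteSpace E]
    (h : ∀ ε > 0, ∃ p > 0, ∀ n, ‖(T ^ n) x - (T ^ (n % p)) x‖ < ε) : HasRelCompactOrbit T x := by
  have htb : TotallyBounded (Set.range fun n : ℕ => (T ^ n) x) := by
    refine Metric.totallyBounded_iff.2 fun ε hε => ?_
    obtain ⟨p, hp, hxp⟩ := h ε hε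
    refine ⟨(fun r => (T ^ r) x) '' Set.Iio p, (Set.finite_Iio p).image _,
      Set.range_subset_iff.2 fun n => ?_⟩
    refine Set.mem_biUnion (Set.mem_image_of_mem _ (Nat.mod_lt n hp)) ?_
    rw [Metric.mem_ball, dist_eq_norm]
    exact hxp n
  exact htb.closure.isCompact_of_isClosed isClosed_closure

theorem HasRelCompactOrbit.exists_lt_norm_sub_lt (h : HasRelCompactOrbit T x) (φ : ℕ → ℕ) {ε : ℝ}
    (hε : 0 < ε) : ∃ i j, i < j ∧ ‖(T ^ φ i) x - (T ^ φ j) x‖ < ε := by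
  obtain ⟨z, -, ψ, hψ, hz⟩ := IsCompact.tendsto_subseq h
    (x := fun i => (T ^ φ i) x) fun i => subset_closure ⟨φ i, rfl⟩
  obtain ⟨N, hN⟩ := Metric.cauchySeq_iff.1 hz.cauchySeq ε hε
  refine ⟨ψ N, ψ (N + 1), hψ N.lt_succ_self, ?_⟩
  rw [← dist_eq_norm]
  exact hN N le_rfl (N + 1) N.le_succ

end AlmostPeriods

section Counterexample

/-- A primitive `2 ^ (n + 2)`-th root of unity. These numbers converge to `-1`, but their
`2 ^ (n + 1)`-th powers are `-1`, while those of `-1` are `1`. -/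
noncomputable def rootSeq (n : ℕ) : ℂ := -Complex.exp ((Real.pi / 2 ^ (n + 1) : ℝ) * Complex.I)

theorem norm_rootSeq (n : ℕ) : ‖rootSeq n‖ = 1 := by
  rw [rootSeq, norm_neg, Complex.norm_exp_ofReal_mul_I]

theorem tendsto_rootSeq : Tendsto rootSeq atTop (𝓝 (-1)) := by
  have hangle : Tendsto (fun n : ℕ => Real.pi / 2 ^ (n + 1)) atTop (𝓝 0) :=
    tendsto_const_nhds.div_atTop
      ((tendsto_pow_atTop_atTop_of_one_lt one_lt_two).comp (tendsto_add_atTop_nat 1))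
  have hcont : Continuous fun t : ℝ => -Complex.exp (t * Complex.I) := by fun_prop
  have hzero : -Complex.exp ((0 : ℝ) * Complex.I) = -1 := by simp
  exact hzero ▸ (hcont.tendsto 0).comp hangle

theorem rootSeq_pow (n : ℕ) : rootSeq n ^ 2 ^ (n + 1) = -1 := by
  rw [rootSeq, (Nat.even_pow.2 ⟨even_two, n.succ_ne_zero⟩).neg_pow, ← Complex.exp_nat_mul,
    ← Complex.exp_pi_mul_I]
  congr 1
  push_cast
  field_simp

theorem rootSeq_pow_eq_one {n j : ℕ} (h : n < j) : rootSeq n ^ 2 ^ (j + 1) = 1 := by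
  obtain ⟨i, rfl⟩ := Nat.exists_eq_add_of_lt h
  rw [add_right_comm _ i, add_assoc _ i, pow_add, pow_mul, rootSeq_pow,
    (Nat.even_pow.2 ⟨even_two, i.succ_ne_zero⟩).neg_one_pow]

theorem one_le_norm_one_sub_rootSeq (n : ℕ) : 1 ≤ ‖1 - rootSeq n‖ := by
  have hangle : Real.pi / 2 ^ (n + 1) ≤ Real.pi / 2 :=
    div_le_div_of_nonneg_left Real.pi_pos.le two_pos (le_self_pow₀ one_le_two n.succ_ne_zero)
  have hcos : 0 ≤ Real.cos (Real.pi / 2 ^ (n + 1)) :=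
    Real.cos_nonneg_of_neg_pi_div_two_le_of_le
      ((neg_nonpos.2 Real.pi_div_two_pos.le).trans (by positivity)) hangle
  calc 1 ≤ (1 - rootSeq n).re := by
        rw [rootSeq, sub_neg_eq_add, Complex.add_re, Complex.one_re,
          Complex.exp_ofReal_mul_I_re]
        linarith
    _ ≤ ‖1 - rootSeq n‖ := Complex.re_le_norm _

/-- The sequence `rootSeq` as a unitary of `C(OnePoint ℕ, ℂ)`, the algebra of convergent
sequences. -/
noncomputable def rootUnitary : unitary C(OnePoint ℕ, ℂ) :=
  ⟨OnePoint.continuousMapMkNat rootSeq (-1) tendsto_rootSeq, Unitary.mem_iff_star_mul_self.2 <| by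
    ext z
    induction z using OnePoint.rec with
    | infty => exact (Complex.conj_mul' (-1)).trans (by simp)
    | coe n => exact (Complex.conj_mul' (rootSeq n)).trans (by simp [norm_rootSeq])⟩

theorem rootUnitary_coe (n : ℕ) : (rootUnitary : C(OnePoint ℕ, ℂ)) n = rootSeq n := rfl

theorem rootUnitary_infty : (rootUnitary : C(OnePoint ℕ, ℂ)) ∞ = -1 := rfl

theorem norm_rootUnitary_apply (z : OnePoint ℕ) :
    ‖(rootUnitary : C(OnePoint ℕ, ℂ)) z‖ = 1 := by
  induction z using OnePoint.rec with
  | infty => rw [rootUnitary_infty, norm_neg, norm_one]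
  | coe n => rw [rootUnitary_coe, norm_rootSeq]

/-- Multiplication by `rootUnitary` on the space of convergent sequences. -/
noncomputable def rootOperator : C(OnePoint ℕ, ℂ) →L[ℂ] C(OnePoint ℕ, ℂ) :=
  (Unitary.mulLeft ℂ _ rootUnitary).toContinuousLinearEquiv

theorem isDoublyPowerBounded_rootOperator : IsDoublyPowerBounded rootOperator :=
  isDoublyPowerBounded_linearIsometryEquiv _

theorem rootOperator_apply (g : C(OnePoint ℕ, ℂ)) (z : OnePoint ℕ) :
    rootOperator g z = (rootUnitary : C(OnePoint ℕ, ℂ)) z * g z := rfl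

theorem rootOperator_pow_apply (n : ℕ) (g : C(OnePoint ℕ, ℂ)) (z : OnePoint ℕ) :
    (rootOperator ^ n) g z = (rootUnitary : C(OnePoint ℕ, ℂ)) z ^ n * g z := by
  induction n with
  | zero => rw [pow_zero, pow_zero, one_apply_eq_self, one_mul]
  | succ n ih =>
    rw [pow_succ', mul_apply_eq_comp, rootOperator_apply, ih, pow_succ', mul_assoc]

theorem norm_rootOperator_pow_sub_pow_apply_le (m n : ℕ) (g : C(OnePoint ℕ, ℂ)) (z : OnePoint ℕ) :
    ‖((rootOperator ^ m) g - (rootOperator ^ n) g) z‖ ≤ 2 * ‖g z‖ := by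
  rw [ContinuousMap.sub_apply, rootOperator_pow_apply, rootOperator_pow_apply, two_mul]
  refine norm_sub_le_of_le ?_ ?_ <;>
    rw [norm_mul, norm_pow, norm_rootUnitary_apply, one_pow, one_mul]

theorem hasRelCompactOrbit_rootOperator {g : C(OnePoint ℕ, ℂ)} (hg : g ∞ = 0) :
    HasRelCompactOrbit rootOperator g := by
  refine hasRelCompactOrbit_of_forall_norm_pow_sub_pow_mod_lt fun ε hε => ?_
  have hlim : Tendsto (fun n : ℕ => g n) atTop (𝓝 0) :=
    hg ▸ (OnePoint.continuous_iff_from_nat g).1 g.continuous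
  obtain ⟨N, hN⟩ := NormedAddCommGroup.tendsto_atTop.1 hlim (ε / 2) (half_pos hε)
  have hsmall (n : ℕ) {z : OnePoint ℕ} (hz : ‖g z‖ < ε / 2) :
      ‖((rootOperator ^ n) g - (rootOperator ^ (n % 2 ^ (N + 1))) g) z‖ < ε :=
    (norm_rootOperator_pow_sub_pow_apply_le _ _ g z).trans_lt (by linarith)
  refine ⟨2 ^ (N + 1), by positivity, fun n => (ContinuousMap.norm_lt_iff _ hε).2 fun z => ?_⟩
  induction z using OnePoint.rec with
  | infty => exact hsmall n (by rw [hg, norm_zero]; exact half_pos hε)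
  | coe i =>
    rcases lt_or_ge i N with hi | hi
    · rw [ContinuousMap.sub_apply, rootOperator_pow_apply, rootOperator_pow_apply, rootUnitary_coe,
        ← pow_eq_pow_mod n (rootSeq_pow_eq_one hi), sub_self, norm_zero]
      exact hε
    · exact hsmall n (by simpa using hN i hi)

theorem hasRelCompactOrbitsOn_rootOperator_two :
    HasRelCompactOrbitsOn rootOperator
      (Set.range (1 - rootOperator ^ 2 : C(OnePoint ℕ, ℂ) →L[ℂ] C(OnePoint ℕ, ℂ))) := by
  rintro _ ⟨g, rfl⟩
  refine hasRelCompactOrbit_rootOperator ?_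
  rw [sub_apply, one_apply_eq_self, ContinuousMap.sub_apply, rootOperator_pow_apply,
    rootUnitary_infty]
  ring

theorem not_hasRelCompactOrbitsOn_rootOperator_one :
    ¬ HasRelCompactOrbitsOn rootOperator
      (Set.range (1 - rootOperator ^ 1 : C(OnePoint ℕ, ℂ) →L[ℂ] C(OnePoint ℕ, ℂ))) := by
  intro h
  have hw : HasRelCompactOrbit rootOperator ((1 - rootOperator ^ 1 : _ →L[ℂ] _) 1) := h _ ⟨1, rfl⟩
  obtain ⟨i, j, hij, hlt⟩ := hw.exists_lt_norm_sub_lt (fun k => 2 ^ (k + 1)) two_pos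
  have hi : ‖-1 * (1 - rootSeq i) - 1 * (1 - rootSeq i)‖ < 2 := by
    simpa only [ContinuousMap.sub_apply, sub_apply, one_apply_eq_self, ContinuousMap.one_apply,
      rootOperator_pow_apply, rootOperator_apply, rootUnitary_coe, rootSeq_pow,
      rootSeq_pow_eq_one hij, pow_one, mul_one] using
      (ContinuousMap.norm_coe_le_norm _ (i : OnePoint ℕ)).trans_lt hlt
  rw [← sub_mul, norm_mul, show (-1 - 1 : ℂ) = -2 by norm_num, norm_neg, Complex.norm_ofNat] at hi
  linarith [one_le_norm_one_sub_rootSeq i]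

theorem not_someIffEachRelCompactOrbits_rootOperator :
    ¬ SomeIffEachRelCompactOrbits rootOperator := fun h =>
  not_hasRelCompactOrbitsOn_rootOperator_one
    (h.1 ⟨2, one_le_two, hasRelCompactOrbitsOn_rootOperator_two⟩ 1 le_rfl)

end Counterexample

theorem not_containsCopyOfC0_of_forall_someIffEachRelCompactOrbits {E : Type*}
    [NormedAddCommGroup E] [NormedSpace ℂ E] [TopologicalSpace.SeparableSpace E]
    (hE : ∀ S : E →L[ℂ] E, IsDoublyPowerBounded S → SomeIffEachRelCompactOrbits S) :
    ¬ ContainsCopyOfC0 E := by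
  intro h
  obtain ⟨J, hJ⟩ := h.exists_hasLeftInverse
  exact not_someIffEachRelCompactOrbits_rootOperator <|
    someIffEachRelCompactOrbits_of_hasLeftInverse
      (hJ.comp (hasLeftInverse_onePointToZeroAtInftyCLM ℂ)) hE isDoublyPowerBounded_rootOperator

theorem theorem4p2 (E : Type*) [NormedAddCommGroup E] [NormedSpace ℂ E] [CompleteSpace E] :
    (¬ ContainsCopyOfC0 E →
      ∀ T : E →L[ℂ] E, IsPowerBounded T → IsPowerBoundedBelow T →
        SomeIffEachRelCompactOrbits T) ∧
    ((∀ T : E →L[ℂ] E, IsPowerBounded T → IsPowerBoundedBelow T →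
        SomeIffEachRelCompactOrbits T) →
      ∀ T : E →L[ℂ] E, IsDoublyPowerBounded T → SomeIffEachRelCompactOrbits T) ∧
    (TopologicalSpace.SeparableSpace E →
      List.TFAE [
        ¬ ContainsCopyOfC0 E,
        ∀ T : E →L[ℂ] E, IsPowerBounded T → IsPowerBoundedBelow T →
          SomeIffEachRelCompactOrbits T,
        ∀ T : E →L[ℂ] E, IsDoublyPowerBounded T → SomeIffEachRelCompactOrbits T]) := by
  have hab (hE : ¬ ContainsCopyOfC0 E) (T : E →L[ℂ] E) (hT : IsPowerBounded T)
      (hbelow : IsPowerBoundedBelow T) : SomeIffEachRelCompactOrbits T :=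
    someIffEachRelCompactOrbits_of_not_containsCopyOfC0 hE hT hbelow
  have hbc (h : ∀ T : E →L[ℂ] E, IsPowerBounded T → IsPowerBoundedBelow T →
        SomeIffEachRelCompactOrbits T) (T : E →L[ℂ] E) (hT : IsDoublyPowerBounded T) :
      SomeIffEachRelCompactOrbits T :=
    h T hT.isPowerBounded hT.isPowerBoundedBelow
  refine ⟨hab, hbc, fun _ => ?_⟩
  tfae_have 1 → 2 := hab
  tfae_have 2 → 3 := hbc
  tfae_have 3 → 1 := not_containsCopyOfC0_of_forall_someIffEachRelCompactOrbits
  tfae_finish
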